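/- **Product rule for weak fractional derivatives.** Let $-\infty<a<b<\infty$ and $0<\alpha<1$. For $\varphi\in C_0^\infty((a,b))$, extended by zero to $\mathbb{R}$, put $${}^{-}D^{\alpha}\varphi(x)=\frac{1}{\Gamma(1-\alpha)}\frac{d}{dx}\int_{-\infty}^{x}\frac{\varphi(y)}{(x-y)^{\alpha}}\,dy,\qquad {}^{+}D^{\alpha}\varphi(x)=-\frac{1}{\Gamma(1-\alpha)}\frac{d}{dx}\int_{x}^{\infty}\frac{\varphi(y)}{(y-x)^{\alpha}}\,dy .$$ For $u\in L^1((a,b))$, a function $v\in L^1_{loc}((a,b))$ is the left (upper sign) or right (lower sign) weak fractional derivative of $u$ of order $\alpha$, written $v={}^{\mp}\mathcal{D}^{\alpha}u$, if $\int_a^b v\,\varphi\,dx=\int_a^b u\;{}^{\pm}D^{\alpha}\varphi\,dx$ for all $\varphi\in C_0^\infty((a,b))$. For $\sigma>0$ let $${}^{-}I^{\sigma}u(x)=\frac1{\Gamma(\sigma)}\int_a^x\frac{u(y)}{(x-y)^{1-\sigma}}\,dy,\qquad {}^{+}I^{\sigma}u(x)=\frac1{\Gamma(\sigma)}\int_x^b\frac{u(y)}{(y-x)^{1-\sigma}}\,dy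 .$$ Let $m\ge 1$, $\psi\in C^{m+1}([a,b])$, $u\in L^1((a,b))$, and set $C_{k,\alpha}=\dfrac{\Gamma(1+\alpha)}{\Gamma(1+k)\,\Gamma(1-k+\alpha)}$. (Left) If ${}^{-}\mathcal{D}^{\alpha}u\in L^1_{loc}((a,b))$ exists, then ${}^{-}\mathcal{D}^{\alpha}(u\psi)$ exists, and for almost every $x\in(a,b)$ all integrals over $y$ below converge absolutely and $${}^{-}\mathcal{D}^{\alpha}(u\psi)(x)={}^{-}\mathcal{D}^{\alpha}u(x)\,\psi(x)+\sum_{k=1}^{m}C_{k,\alpha}\;{}^{-}I^{k-\alpha}u(x)\,\psi^{(k)}(x)+{}^{-}R^{\alpha}_m(u,\psi)(x),$$ $${}^{-}R^{\alpha}_m(u,\psi)(x)=\frac{(-1)^{m+1}}{m!\,\Gamma(-\alpha)}\int_a^x\frac{u(y)}{(x-y)^{1+\alpha}}\int_y^x\psi^{(m+1)}(z)\,(z-y)^m\,dz\,dy .$$ (Right) If ${}^{+}\mathcal{D}^{\alpha}u\in L^1_{loc}((a,b))$ exists, then ${}^{+}\mathcal{D}^{\alpha}(u\psi)$ exists, and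 for almost every $x\in(a,b)$ all integrals over $y$ below converge absolutely and $${}^{+}\mathcal{D}^{\alpha}(u\psi)(x)={}^{+}\mathcal{D}^{\alpha}u(x)\,\psi(x)+\sum_{k=1}^{m}(-1)^k C_{k,\alpha}\;{}^{+}I^{k-\alpha}u(x)\,\psi^{(k)}(x)+{}^{+}R^{\alpha}_m(u,\psi)(x),$$ $${}^{+}R^{\alpha}_m(u,\psi)(x)=\frac{1}{m!\,\Gamma(-\alpha)}\int_x^b\frac{u(y)}{(y-x)^{1+\alpha}}\int_x^y\psi^{(m+1)}(z)\,(y-z)^m\,dz\,dy .$$ -/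

import Mathlib

open MeasureTheory Set
open scoped ContDiff

noncomputable section

/-- Integrand of the left Riemann–Liouville integral of order `σ` at the point `x`. -/
def leftRLIntegrand (σ : ℝ) (f : ℝ → ℝ) (x y : ℝ) : ℝ := f y / (x - y) ^ (1 - σ)

/-- Integrand of the right Riemann–Liouville integral of order `σ` at the point `x`. -/
def rightRLIntegrand (σ : ℝ) (f : ℝ → ℝ) (x y : ℝ) : ℝ := f y / (y - x) ^ (1 - σ)

/-- Left Riemann–Liouville integral of order `σ > 0` on an interval with left end point `a`. -/
def leftRLIntegral (a σ : ℝ) (f : ℝ → ℝ) (x : ℝ) : ℝ :=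
  1 / Real.Gamma σ * ∫ y in Ioo a x, leftRLIntegrand σ f x y

/-- Right Riemann–Liouville integral of order `σ > 0` on an interval with right end point `b`. -/
def rightRLIntegral (b σ : ℝ) (f : ℝ → ℝ) (x : ℝ) : ℝ :=
  1 / Real.Gamma σ * ∫ y in Ioo x b, rightRLIntegrand σ f x y

/-- Left Liouville derivative on `ℝ` of order `α`, for `0 < α < 1`. -/
def leftLiouvilleDeriv (α : ℝ) (f : ℝ → ℝ) (x : ℝ) : ℝ :=
  deriv (fun t => 1 / Real.Gamma (1 - α) * ∫ y in Iio t, f y / (t - y) ^ α) x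

/-- Right Liouville derivative on `ℝ` of order `α`, for `0 < α < 1`. -/
def rightLiouvilleDeriv (α : ℝ) (f : ℝ → ℝ) (x : ℝ) : ℝ :=
  -deriv (fun t => 1 / Real.Gamma (1 - α) * ∫ y in Ioi t, f y / (y - t) ^ α) x

/-- Smooth functions with compact support in `(a, b)`, already extended by zero to `ℝ`. -/
structure IsTestFunction (a b : ℝ) (φ : ℝ → ℝ) : Prop where
  smooth : ContDiff ℝ ∞ φ
  compact : HasCompactSupport φ
  support : tsupport φ ⊆ Ioo a b

/-- `v ∈ L¹_loc((a, b))` is a left weak fractional derivative of order `α` (with `0 < α < 1`) of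
`u ∈ L¹((a, b))`. -/
structure IsLeftWeakFracDeriv (a b α : ℝ) (u v : ℝ → ℝ) : Prop where
  integrable : IntegrableOn u (Ioo a b)
  locallyIntegrable : LocallyIntegrableOn v (Ioo a b)
  integral_eq : ∀ φ : ℝ → ℝ, IsTestFunction a b φ →
    ∫ x in Ioo a b, v x * φ x = ∫ x in Ioo a b, u x * rightLiouvilleDeriv α φ x

/-- `v ∈ L¹_loc((a, b))` is a right weak fractional derivative of order `α` (with `0 < α < 1`) of
`u ∈ L¹((a, b))`. -/
structure IsRightWeakFracDeriv (a b α : ℝ) (u v : ℝ → ℝ) : Prop where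
  integrable : IntegrableOn u (Ioo a b)
  locallyIntegrable : LocallyIntegrableOn v (Ioo a b)
  integral_eq : ∀ φ : ℝ → ℝ, IsTestFunction a b φ →
    ∫ x in Ioo a b, v x * φ x = ∫ x in Ioo a b, u x * leftLiouvilleDeriv α φ x

/-- The coefficient `Γ(1 + α) / (Γ(1 + k) Γ(1 - k + α))`. -/
def fracBinom (α : ℝ) (k : ℕ) : ℝ :=
  Real.Gamma (1 + α) / (Real.Gamma (1 + k) * Real.Gamma (1 - k + α))

/-- The derivative of order `k` on `[a, b]`, one-sided at the end points. -/
def derivOn (a b : ℝ) (k : ℕ) (ψ : ℝ → ℝ) : ℝ → ℝ := iteratedDerivWithin k ψ (Icc a b)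

/-- Outer integrand of the left remainder. -/
def leftRemainderIntegrand (a b α : ℝ) (m : ℕ) (u ψ : ℝ → ℝ) (x y : ℝ) : ℝ :=
  u y / (x - y) ^ (1 + α) * ∫ z in y..x, derivOn a b (m + 1) ψ z * (z - y) ^ m

/-- The left remainder in the product rule. -/
def leftRemainder (a b α : ℝ) (m : ℕ) (u ψ : ℝ → ℝ) (x : ℝ) : ℝ :=
  (-1) ^ (m + 1) / (m.factorial * Real.Gamma (-α)) *
    ∫ y in Ioo a x, leftRemainderIntegrand a b α m u ψ x y

/-- Outer integrand of the right remainder. -/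
def rightRemainderIntegrand (a b α : ℝ) (m : ℕ) (u ψ : ℝ → ℝ) (x y : ℝ) : ℝ :=
  u y / (y - x) ^ (1 + α) * ∫ z in x..y, derivOn a b (m + 1) ψ z * (y - z) ^ m

/-- The right remainder in the product rule. -/
def rightRemainder (a b α : ℝ) (m : ℕ) (u ψ : ℝ → ℝ) (x : ℝ) : ℝ :=
  1 / (m.factorial * Real.Gamma (-α)) *
    ∫ y in Ioo x b, rightRemainderIntegrand a b α m u ψ x y

end

open Filter Topology
open scoped Convolution

/-! The proof computes the commutator of the fractional derivative with multiplication by `ψ`. Let D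
be the right Liouville derivative and `φ` a test function. For fixed y the function `(ψ x - ψ y) * φ
x` vanishes at x = y, so an integration by parts turns D(ψφ)(y) - ψ(y) Dφ(y) into 1/Γ(-α) times the
integral over x > y of (ψ(x) - ψ(y)) φ(x) / (x - y)^(1+α) (`rightLiouvilleDeriv_mul_sub`).
Multiplying by `u` and exchanging integrals over a < y < x < b shows that vψ minus 1/Γ(-α) times the
integral of `commIntegrand` is a weak derivative of uψ (`IsLeftWeakFracDeriv.mul`). Fubini applies
because `ψ` is Lipschitz on [a, b], which lowers the singularity to the integrable (x - y)^(-α).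

The argument tests `v` against ψφ, which need not be smooth;
`IsLeftWeakFracDeriv.integral_eq_of_contDiff_one` extends the defining identity to such functions by
mollification.

Expanding ψ(x) - ψ(y) by Taylor's formula at x then splits the commutator into fractional integrals
of `u` and the remainder (`commIntegrand_eq`), with constants matched by `Gamma_reflection_shift`.
Uniqueness (`IsLeftWeakFracDeriv.ae_eq`) transfers the formula to every weak derivative of uψ, and x
↦ -x gives the right-hand case. -/

/-! ### The singular kernel and the right Liouville derivative of `C¹` functions -/

theorem integrableOn_Ioc_rpow_neg {α : ℝ} (hα1 : α < 1) (L : ℝ) :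
    IntegrableOn (fun t : ℝ => t ^ (-α)) (Ioc 0 L) := by
  rcases le_or_gt 0 L with hL | hL
  · exact (intervalIntegrable_iff_integrableOn_Ioc_of_le hL).1
      (intervalIntegral.intervalIntegrable_rpow' (by linarith))
  · simp [Ioc_eq_empty (not_lt.2 hL.le)]

/-- The kernel `t ^ (-α)` restricted to `(0, L)`. -/
noncomputable def truncKernel (α L : ℝ) : ℝ → ℝ := (Ioo 0 L).indicator (fun t => t ^ (-α))

theorem integrable_truncKernel {α : ℝ} (hα1 : α < 1) (L : ℝ) : Integrable (truncKernel α L) :=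
  (integrable_indicator_iff measurableSet_Ioo).2
    ((integrableOn_Ioc_rpow_neg hα1 L).mono_set Ioo_subset_Ioc_self)

theorem truncKernel_nonneg (α L t : ℝ) : 0 ≤ truncKernel α L t :=
  indicator_nonneg (fun _ ht => Real.rpow_nonneg ht.1.le _) t

theorem locallyIntegrable_negKernel {α : ℝ} (hα1 : α < 1) :
    LocallyIntegrable ((Iio (0 : ℝ)).indicator (fun s => (-s) ^ (-α))) := by
  rw [locallyIntegrable_iff]
  intro K hK
  obtain ⟨R, hR⟩ := hK.isBounded.subset_closedBall 0
  have h1 : IntegrableOn (fun s : ℝ => (-s) ^ (-α)) (Ico (-R) 0) := by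
    have h := (integrable_indicator_iff measurableSet_Ioc).2 (integrableOn_Ioc_rpow_neg hα1 R)
    have h2 := h.comp_neg
    rw [← integrable_indicator_iff measurableSet_Ico]
    refine h2.congr (Eventually.of_forall fun s => ?_)
    by_cases hs : s ∈ Ico (-R) 0
    · have h3 : -s ∈ Ioc 0 R := ⟨by linarith [hs.2], by linarith [hs.1]⟩
      simp only [indicator_of_mem hs, indicator_of_mem h3]
    · have h3 : -s ∉ Ioc 0 R := fun h => hs ⟨by linarith [h.2], by linarith [h.1]⟩
      simp only [indicator_of_notMem hs, indicator_of_notMem h3]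
  rw [IntegrableOn, integrable_indicator_iff measurableSet_Iio, IntegrableOn,
    Measure.restrict_restrict measurableSet_Iio]
  refine h1.mono_set fun x hx => ⟨?_, hx.1⟩
  have := hR hx.2
  rw [Metric.mem_closedBall, dist_zero_right, Real.norm_eq_abs, abs_le] at this
  exact this.1

/-- The integral over (t, ∞) is a convolution with a locally integrable kernel supported on the
negative half-line, so the derivative can be moved onto `g`. -/
theorem rightLiouvilleDeriv_eq {α : ℝ} (hα1 : α < 1) {g : ℝ → ℝ} (hg : ContDiff ℝ 1 g)
    (hgc : HasCompactSupport g) (y : ℝ) :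
    rightLiouvilleDeriv α g y =
      -(1 / Real.Gamma (1 - α)) * ∫ x in Ioi y, deriv g x / (x - y) ^ α := by
  have key : ∀ (f : ℝ → ℝ) (t : ℝ), ∫ x in Ioi t, f x / (x - t) ^ α =
      (((Iio (0 : ℝ)).indicator (fun s => (-s) ^ (-α))) ⋆[ContinuousLinearMap.mul ℝ ℝ, volume] f)
        t := by
    intro f t
    rw [convolution_def, ← integral_sub_left_eq_self _ volume t, ← integral_indicator measurableSet_Ioi]
    refine integral_congr_ae (Eventually.of_forall fun x => ?_)
    by_cases hx : t < x
    · have h2 : t - x ∈ Iio (0 : ℝ) := by simpa using hx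
      simp only [indicator_of_mem (show x ∈ Ioi t from hx), indicator_of_mem h2, neg_sub,
        sub_sub_cancel, ContinuousLinearMap.mul_apply']
      rw [Real.rpow_neg (by linarith)]
      ring
    · have h2 : t - x ∉ Iio (0 : ℝ) := by simpa using hx
      simp [indicator_of_notMem (show x ∉ Ioi t from hx), indicator_of_notMem h2]
  have h := hgc.hasDerivAt_convolution_right (ContinuousLinearMap.mul ℝ ℝ)
    (locallyIntegrable_negKernel hα1) hg y
  rw [← key] at h
  have h' : HasDerivAt (fun t => 1 / Real.Gamma (1 - α) * ∫ x in Ioi t, g x / (x - t) ^ α)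
      (1 / Real.Gamma (1 - α) * ∫ x in Ioi y, deriv g x / (x - y) ^ α) y := by
    have h3 := h.const_mul (1 / Real.Gamma (1 - α))
    refine h3.congr_of_eventuallyEq (Eventually.of_forall fun t => ?_)
    simp only [key]
  rw [rightLiouvilleDeriv, h'.deriv, neg_mul]

/-- Common majorant for the singular integrals below: vanishing beyond `R` allows the kernel to be
cut off at `L`, where it is integrable once α < 1. -/
theorem norm_indicator_le_truncKernel {α y R L C : ℝ} (hC : 0 ≤ C) (hL : R - y ≤ L) {G : ℝ → ℝ}
    (h1 : ∀ x, y < x → |G x| ≤ C * ((x - y) ^ α)⁻¹) (h2 : ∀ x, R ≤ x → G x = 0) (x : ℝ) :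
    ‖(Ioi y).indicator G x‖ ≤ C * truncKernel α L (x - y) := by
  by_cases hx : x ∈ Ioi y ∧ x < R
  · have h3 : x - y ∈ Ioo 0 L := ⟨sub_pos.2 hx.1, by linarith [hx.2]⟩
    rw [indicator_of_mem hx.1, truncKernel, indicator_of_mem h3, Real.rpow_neg h3.1.le]
    exact h1 x hx.1
  · have : (Ioi y).indicator G x = 0 := by
      by_cases h : x ∈ Ioi y
      · rw [indicator_of_mem h, h2 x (not_lt.1 fun h' => hx ⟨h, h'⟩)]
      · rw [indicator_of_notMem h]
    rw [this, norm_zero]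
    exact mul_nonneg hC (truncKernel_nonneg _ _ _)

theorem abs_div_rpow_le {α t c C : ℝ} (ht : 0 < t) (h : |c| ≤ C) : |c / t ^ α| ≤ C * (t ^ α)⁻¹ := by
  rw [abs_div, abs_of_nonneg (Real.rpow_nonneg ht.le α), div_eq_mul_inv]
  exact mul_le_mul_of_nonneg_right h (inv_nonneg.2 (Real.rpow_nonneg ht.le α))

theorem HasCompactSupport.exists_forall_ge_eq_zero {F : ℝ → ℝ} (hF : HasCompactSupport F) :
    ∃ R, ∀ x, R ≤ x → F x = 0 := by
  obtain ⟨R, hR⟩ := hF.isCompact.isBounded.subset_closedBall 0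
  refine ⟨R + 1, fun x hx => ?_⟩
  by_contra h0
  have h2 := hR (subset_tsupport F h0)
  rw [Metric.mem_closedBall, dist_zero_right, Real.norm_eq_abs, abs_le] at h2
  linarith [h2.2]

/-- If `F` is bounded by `ε` and vanishes beyond `b`, its fractional integral is bounded by a
multiple of `ε`. -/
theorem abs_fracIntegral_le {α a b ε : ℝ} (hα1 : α < 1) {F : ℝ → ℝ} (hF : ∀ x, |F x| ≤ ε)
    (hFb : ∀ x, b ≤ x → F x = 0) {y : ℝ} (hy : a < y) :
    |∫ x in Ioi y, F x / (x - y) ^ α| ≤ ε * ∫ t, truncKernel α (b - a) t := by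
  rw [← integral_sub_right_eq_self (truncKernel α (b - a)) y, ← integral_const_mul,
    ← integral_indicator measurableSet_Ioi, ← Real.norm_eq_abs]
  refine norm_integral_le_of_norm_le
    (((integrable_truncKernel hα1 (b - a)).comp_sub_right y).const_mul ε)
    (Eventually.of_forall (norm_indicator_le_truncKernel ((abs_nonneg _).trans (hF 0))
      (sub_le_sub_left hy.le b) (fun x hx => abs_div_rpow_le (sub_pos.2 hx) (hF x))
      fun x hx => by rw [hFb x hx, zero_div]))

theorem integrableOn_div_sub_rpow {α : ℝ} (hα1 : α < 1) {F : ℝ → ℝ} (hF : Continuous F)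
    (hFc : HasCompactSupport F) (y : ℝ) : IntegrableOn (fun x => F x / (x - y) ^ α) (Ioi y) := by
  obtain ⟨C, hC⟩ := hFc.exists_bound_of_continuous hF
  obtain ⟨R, hR⟩ := hFc.exists_forall_ge_eq_zero
  rw [← integrable_indicator_iff measurableSet_Ioi]
  refine Integrable.mono' (((integrable_truncKernel hα1 (R - y)).comp_sub_right y).const_mul C)
    ?_ (Eventually.of_forall (norm_indicator_le_truncKernel ((norm_nonneg _).trans (hC 0))
      le_rfl (fun x hx => abs_div_rpow_le (sub_pos.2 hx) (hC x))
      fun x hx => by rw [hR x hx, zero_div]))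
  refine (Measurable.indicator ?_ measurableSet_Ioi).aestronglyMeasurable
  exact hF.measurable.div ((measurable_id.sub_const y).pow_const α)

/-- Integration by parts for a function vanishing at the singularity of the kernel. -/
theorem integral_deriv_div_sub_rpow {α : ℝ} (hα1 : α < 1) {h : ℝ → ℝ}
    (hh : ContDiff ℝ 1 h) (hc : HasCompactSupport h) {y : ℝ} (hy : h y = 0) :
    IntegrableOn (fun x => h x / (x - y) ^ (1 + α)) (Ioi y) ∧
    ∫ x in Ioi y, deriv h x / (x - y) ^ α = α * ∫ x in Ioi y, h x / (x - y) ^ (1 + α) := by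
  have hd : Continuous (deriv h) := hh.continuous_deriv le_rfl
  obtain ⟨C, hC⟩ := hc.deriv.exists_bound_of_continuous hd
  obtain ⟨R, hzero⟩ := hc.exists_forall_ge_eq_zero
  have hC0 : 0 ≤ C := (norm_nonneg _).trans (hC 0)
  -- The zero of `h` at `y` absorbs one power of the singularity, leaving (x - y)^(-α). The same
  -- bound kills the boundary term at `y`, of size at most C (x - y)^(1-α).
  have hlip : ∀ x, |h x| ≤ C * |x - y| := by
    intro x
    have := Convex.norm_image_sub_le_of_norm_deriv_le (f := h) (s := univ) (x := y) (y := x)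
      (fun z _ => hh.differentiable one_ne_zero z) (fun z _ => hC z) convex_univ trivial trivial
    simpa [hy, Real.norm_eq_abs] using this
  have hint : IntegrableOn (fun x => h x / (x - y) ^ (1 + α)) (Ioi y) := by
    rw [← integrable_indicator_iff measurableSet_Ioi]
    refine Integrable.mono'
      (((integrable_truncKernel hα1 (R - y)).comp_sub_right y).const_mul C)
      ?_ (Eventually.of_forall (norm_indicator_le_truncKernel hC0 le_rfl (fun x hx => ?_)
        fun x hx => by rw [hzero x hx, zero_div]))
    · refine (Measurable.indicator ?_ measurableSet_Ioi).aestronglyMeasurable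
      exact hh.continuous.measurable.div ((measurable_id.sub_const y).pow_const (1 + α))
    · have h1 : 0 < x - y := sub_pos.2 hx
      have h3 := hlip x
      rw [abs_of_pos h1] at h3
      refine (abs_div_rpow_le h1 h3).trans_eq ?_
      have h4 := (Real.rpow_pos_of_pos h1 α).ne'
      rw [Real.rpow_add h1, Real.rpow_one]
      field_simp
  refine ⟨hint, ?_⟩
  have e1 : ∀ x ∈ Ioi y, deriv h x / (x - y) ^ α = deriv h x * (x - y) ^ (-α) := by
    intro x hx
    rw [Real.rpow_neg (sub_pos.2 hx).le, div_eq_mul_inv]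
  have e2 : ∀ x ∈ Ioi y, -α * (h x / (x - y) ^ (1 + α)) = h x * (-α * (x - y) ^ (-α - 1)) := by
    intro x hx
    rw [show -α - 1 = -(1 + α) by ring, Real.rpow_neg (sub_pos.2 hx).le, div_eq_mul_inv]
    ring
  have ibp := integral_Ioi_mul_deriv_eq_deriv_mul (a := y) (a' := (0 : ℝ)) (b' := (0 : ℝ)) (u := h)
    (u' := deriv h) (v := fun x => (x - y) ^ (-α)) (v' := fun x => -α * (x - y) ^ (-α - 1))
    (fun x _ => (hh.differentiable one_ne_zero x).hasDerivAt)
    (fun x hx => by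
      have := ((hasDerivAt_id x).sub_const y).rpow_const (p := -α)
        (Or.inl (sub_pos.2 (mem_Ioi.1 hx)).ne')
      simpa using this)
    (IntegrableOn.congr_fun (hint.const_mul (-α)) e2 measurableSet_Ioi)
    ((integrableOn_div_sub_rpow hα1 hd hc.deriv y).congr_fun e1 measurableSet_Ioi)
    (by
      have hb : Tendsto (fun x : ℝ => C * (x - y) ^ (1 - α)) (𝓝[>] y) (𝓝 0) := by
        have : ContinuousAt (fun x : ℝ => C * (x - y) ^ (1 - α)) y :=
          continuousAt_const.mul ((continuousAt_id.sub continuousAt_const).rpow_const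
            (Or.inr (by linarith)))
        have h2 := this.tendsto
        simp only [sub_self, Real.zero_rpow (show 1 - α ≠ 0 by linarith), mul_zero] at h2
        exact h2.mono_left nhdsWithin_le_nhds
      refine squeeze_zero_norm' ?_ hb
      filter_upwards [self_mem_nhdsWithin] with x hx
      have hx' : 0 < x - y := sub_pos.2 hx
      have h3 := hlip x
      rw [abs_of_pos hx'] at h3
      rw [Pi.mul_apply, norm_mul, Real.norm_of_nonneg (Real.rpow_nonneg hx'.le _),
        sub_eq_add_neg 1 α, Real.rpow_add hx', Real.rpow_one, ← mul_assoc]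
      exact mul_le_mul_of_nonneg_right h3 (Real.rpow_nonneg hx'.le _))
    (by
      refine tendsto_const_nhds.congr' ?_
      filter_upwards [eventually_ge_atTop R] with x hx
      rw [Pi.mul_apply, hzero x hx, zero_mul])
  rw [setIntegral_congr_fun measurableSet_Ioi e1]
  rw [← setIntegral_congr_fun measurableSet_Ioi e2, integral_const_mul] at ibp
  linarith

/-! ### Extension to `C¹` test functions, and uniqueness -/

/-- A `C¹` function with compact support is a limit in `C¹`, with supports in a fixed compact set,
of test functions. -/
theorem exists_isTestFunction_close {a b : ℝ} {g : ℝ → ℝ} (hg : ContDiff ℝ 1 g)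
    (hgc : HasCompactSupport g) (hgs : tsupport g ⊆ Ioo a b) :
    ∃ K ⊆ Ioo a b, IsCompact K ∧ tsupport g ⊆ K ∧ ∀ ε > 0, ∃ φ, IsTestFunction a b φ ∧
      tsupport φ ⊆ K ∧ (∀ x, |φ x - g x| ≤ ε) ∧ ∀ x, |deriv φ x - deriv g x| ≤ ε := by
  obtain ⟨δ, hδ, hK⟩ := hgc.isCompact.exists_cthickening_subset_open isOpen_Ioo hgs
  have hd : Continuous (deriv g) := hg.continuous_deriv le_rfl
  refine ⟨Metric.cthickening δ (tsupport g), hK, hgc.isCompact.cthickening,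
    Metric.self_subset_cthickening _, fun ε hε => ?_⟩
  have huc : ∀ f : ℝ → ℝ, Continuous f → HasCompactSupport f →
      ∃ r > 0, ∀ x y, dist x y < r → dist (f x) (f y) < ε := fun f hf hfc =>
    let ⟨r, hr, h⟩ := Metric.uniformContinuous_iff.1 (hfc.uniformContinuous_of_continuous hf) ε hε
    ⟨r, hr, fun _ _ hxy => h hxy⟩
  obtain ⟨r₁, hr₁, h₁⟩ := huc g hg.continuous hgc
  obtain ⟨r₂, hr₂, h₂⟩ := huc (deriv g) hd hgc.deriv
  -- Radius at most `δ` keeps the support in the fixed thickening; `r₁` and `r₂` are the moduli of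
  -- uniform continuity of `g` and `deriv g` for `ε`.
  set r := min δ (min r₁ r₂) with hr
  have hr0 : 0 < r := lt_min hδ (lt_min hr₁ hr₂)
  let ρ : ContDiffBump (0 : ℝ) := ⟨r / 2, r, half_pos hr0, half_lt_self hr0⟩
  have hρ : ContDiff ℝ ∞ (ρ.normed volume) := ρ.contDiff_normed
  have hρc : HasCompactSupport (ρ.normed volume) := ρ.hasCompactSupport_normed
  set φ : ℝ → ℝ := ρ.normed volume ⋆[ContinuousLinearMap.lsmul ℝ ℝ, volume] g with hφ
  have hsupp : tsupport φ ⊆ Metric.cthickening δ (tsupport g) := by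
    refine closure_minimal ?_ Metric.isClosed_cthickening
    refine (support_convolution_subset _).trans ?_
    rintro _ ⟨s, hs, t, ht, rfl⟩
    refine Metric.mem_cthickening_of_dist_le _ t _ _ (subset_tsupport g ht) ?_
    rw [ρ.support_normed_eq, Metric.mem_ball, dist_zero_right] at hs
    simp only [dist_eq_norm, add_sub_cancel_right]
    exact hs.le.trans (min_le_left _ _)
  refine ⟨φ, ⟨hρc.contDiff_convolution_left _ hρ hg.continuous.locallyIntegrable,
    hρc.convolution _ hgc, hsupp.trans hK⟩, hsupp, fun x => ?_, fun x => ?_⟩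
  · rw [← Real.dist_eq]
    exact ρ.dist_normed_convolution_le hg.continuous.aestronglyMeasurable fun z hz =>
      (h₁ z x ((Metric.mem_ball.1 hz).trans_le ((min_le_right _ _).trans (min_le_left _ _)))).le
  · have := (hgc.hasDerivAt_convolution_right (ContinuousLinearMap.lsmul ℝ ℝ)
      (hρ.continuous.locallyIntegrable (μ := volume)) hg x).deriv
    rw [← hφ] at this
    rw [this, ← Real.dist_eq]
    exact ρ.dist_normed_convolution_le hd.aestronglyMeasurable fun z hz =>
      (h₂ z x ((Metric.mem_ball.1 hz).trans_le ((min_le_right _ _).trans (min_le_right _ _)))).le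

theorem eq_zero_of_notMem_tsupport {g : ℝ → ℝ} {K : Set ℝ} (hgs : tsupport g ⊆ K) {x : ℝ}
    (hx : x ∉ K) : g x = 0 := by
  by_contra h
  exact hx (hgs (subset_tsupport g h))

/-- The Liouville derivative of `g` is bounded on (a, b), so integrability of `u` suffices. -/
theorem integrableOn_mul_rightLiouvilleDeriv {a b α : ℝ} (hα1 : α < 1) {u g : ℝ → ℝ}
    (hu : IntegrableOn u (Ioo a b)) (hg : ContDiff ℝ 1 g) (hgc : HasCompactSupport g)
    (hgs : tsupport g ⊆ Ioo a b) :
    IntegrableOn (fun y => u y * rightLiouvilleDeriv α g y) (Ioo a b) := by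
  obtain ⟨C, hC⟩ := hgc.deriv.exists_bound_of_continuous (hg.continuous_deriv le_rfl)
  refine hu.mul_bdd (c := |1 / Real.Gamma (1 - α)| * (C * ∫ t, truncKernel α (b - a) t)) ?_
    (ae_restrict_of_forall_mem measurableSet_Ioo fun y hy => ?_)
  · exact (measurable_deriv _).neg.aestronglyMeasurable
  · rw [rightLiouvilleDeriv_eq hα1 hg hgc, norm_mul, norm_neg]
    exact mul_le_mul_of_nonneg_left (abs_fracIntegral_le hα1 hC
      (fun x hx => eq_zero_of_notMem_tsupport (tsupport_deriv_subset.trans hgs) fun h' => h'.2.not_ge hx) hy.1)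
      (abs_nonneg _)

/-- The defining identity of a weak derivative extends to `C¹` functions with compact support. -/
theorem IsLeftWeakFracDeriv.integral_eq_of_contDiff_one {a b α : ℝ} (hα1 : α < 1) {u v : ℝ → ℝ}
    (h : IsLeftWeakFracDeriv a b α u v) {g : ℝ → ℝ} (hg : ContDiff ℝ 1 g)
    (hgc : HasCompactSupport g) (hgs : tsupport g ⊆ Ioo a b) :
    ∫ x in Ioo a b, v x * g x = ∫ x in Ioo a b, u x * rightLiouvilleDeriv α g x := by
  obtain ⟨K, hK, hKc, hgK, happ⟩ := exists_isTestFunction_close hg hgc hgs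
  have hvK : IntegrableOn v K := h.locallyIntegrable.integrableOn_compact_subset hK hKc
  have hv : ∀ f : ℝ → ℝ, Continuous f → tsupport f ⊆ K →
      IntegrableOn (fun x => v x * f x) K ∧
      ∫ x in Ioo a b, v x * f x = ∫ x in K, v x * f x := fun f hf hfK =>
    ⟨hvK.mul_continuousOn hf.continuousOn hKc, setIntegral_eq_of_subset_of_forall_sdiff_eq_zero
      measurableSet_Ioo hK fun x hx => by rw [eq_zero_of_notMem_tsupport hfK hx.2, mul_zero]⟩
  set A := ∫ x in K, |v x|
  set B := |1 / Real.Gamma (1 - α)| * (∫ t, truncKernel α (b - a) t) * ∫ x in Ioo a b, |u x|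
  have hB : 0 ≤ B := by
    have := integral_nonneg (μ := volume) (f := truncKernel α (b - a)) (truncKernel_nonneg α _)
    positivity
  have hA : 0 ≤ A := by positivity
  -- `A` weighs the uniform error of `φ` against `v` on the fixed compact `K`; `B` weighs the
  -- uniform error of `deriv φ`, through the fractional integral, against `u`.
  have key : ∀ ε > 0,
      |(∫ x in Ioo a b, v x * g x) - ∫ x in Ioo a b, u x * rightLiouvilleDeriv α g x| ≤
        ε * (A + B) := by
    intro ε hε
    obtain ⟨φ, hφ, hφK, h0, h1⟩ := happ ε hε
    have hφ1 : ContDiff ℝ 1 φ := hφ.smooth.of_le (by exact_mod_cast le_top)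
    have e1 : |(∫ x in Ioo a b, v x * g x) - ∫ x in Ioo a b, v x * φ x| ≤ ε * A := by
      obtain ⟨i1, j1⟩ := hv g hg.continuous hgK
      obtain ⟨i2, j2⟩ := hv φ hφ1.continuous hφK
      rw [j1, j2, ← integral_sub i1 i2, ← integral_const_mul, ← Real.norm_eq_abs]
      refine norm_integral_le_of_norm_le (hvK.abs.const_mul ε) (Eventually.of_forall fun x => ?_)
      rw [← mul_sub, norm_mul, mul_comm, Real.norm_eq_abs, abs_sub_comm]
      exact mul_le_mul_of_nonneg_right (h0 x) (abs_nonneg _)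
    have e2 : |(∫ x in Ioo a b, u x * rightLiouvilleDeriv α φ x) -
        ∫ x in Ioo a b, u x * rightLiouvilleDeriv α g x| ≤ ε * B := by
      rw [← integral_sub (integrableOn_mul_rightLiouvilleDeriv hα1 h.integrable hφ1 hφ.compact
        hφ.support) (integrableOn_mul_rightLiouvilleDeriv hα1 h.integrable hg hgc hgs),
        ← mul_assoc, ← integral_const_mul, ← Real.norm_eq_abs]
      refine norm_integral_le_of_norm_le (h.integrable.abs.const_mul _)
        (ae_restrict_of_forall_mem measurableSet_Ioo fun y hy => ?_)
      rw [← mul_sub, norm_mul, mul_comm]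
      refine mul_le_mul_of_nonneg_right ?_ (abs_nonneg _)
      rw [rightLiouvilleDeriv_eq hα1 hφ1 hφ.compact, rightLiouvilleDeriv_eq hα1 hg hgc, ← mul_sub,
        ← integral_sub (integrableOn_div_sub_rpow hα1 (hφ1.continuous_deriv le_rfl)
          hφ.compact.deriv y) (integrableOn_div_sub_rpow hα1 (hg.continuous_deriv le_rfl)
          hgc.deriv y), norm_mul, norm_neg, mul_left_comm]
      refine mul_le_mul_of_nonneg_left ?_ (abs_nonneg _)
      simp only [← sub_div]
      exact abs_fracIntegral_le hα1 h1 (fun x hx => by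
        rw [eq_zero_of_notMem_tsupport (tsupport_deriv_subset.trans hφ.support) fun h' => h'.2.not_ge hx,
          eq_zero_of_notMem_tsupport (tsupport_deriv_subset.trans hgs) fun h' => h'.2.not_ge hx, sub_zero]) hy.1
    rw [h.integral_eq φ hφ] at e1
    calc _ ≤ _ := abs_sub_le _ (∫ x in Ioo a b, u x * rightLiouvilleDeriv α φ x) _
      _ ≤ ε * A + ε * B := add_le_add e1 e2
      _ = ε * (A + B) := by ring
  refine sub_eq_zero.1 (abs_nonpos_iff.1 (le_of_forall_pos_le_add fun η hη => ?_))
  -- The added 1 covers the case A + B = 0.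
  have hpos : 0 < A + B + 1 := by positivity
  refine (key (η / (A + B + 1)) (by positivity)).trans ?_
  rw [zero_add, div_mul_eq_mul_div, div_le_iff₀ hpos]
  nlinarith

/-- This is the fundamental lemma of the calculus of variations applied to `w - v`. -/
theorem IsLeftWeakFracDeriv.ae_eq {a b α : ℝ} {u v w : ℝ → ℝ} (hv : IsLeftWeakFracDeriv a b α u v)
    (hw : IsLeftWeakFracDeriv a b α u w) : ∀ᵐ x ∂volume.restrict (Ioo a b), w x = v x := by
  rw [ae_restrict_iff' measurableSet_Ioo]
  have := isOpen_Ioo.ae_eq_zero_of_integral_contDiff_smul_eq_zero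
    (hw.locallyIntegrable.sub hv.locallyIntegrable) (μ := volume) fun g hg hgc hgs => by
      have hi : ∀ f : ℝ → ℝ, LocallyIntegrableOn f (Ioo a b) →
          IntegrableOn (fun x => f x * g x) (Ioo a b) := fun f hf => by
        have h1 : IntegrableOn (fun x => f x * g x) (tsupport g) :=
          (hf.integrableOn_compact_subset hgs hgc.isCompact).mul_continuousOn
            hg.continuous.continuousOn hgc.isCompact
        refine (IntegrableOn.of_forall_sdiff_eq_zero h1 measurableSet_Ioo fun x hx => ?_)
        rw [image_eq_zero_of_notMem_tsupport hx.2, mul_zero]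
      have e := (hw.integral_eq g ⟨hg, hgc, hgs⟩).trans (hv.integral_eq g ⟨hg, hgc, hgs⟩).symm
      rw [← setIntegral_eq_integral_of_forall_compl_eq_zero (s := Ioo a b)]
      · simp only [Pi.sub_apply, smul_eq_mul, mul_sub]
        rw [integral_sub]
        · simp only [mul_comm (g _)]
          rw [e, sub_self]
        · simpa only [mul_comm (g _), IntegrableOn] using hi w hw.locallyIntegrable
        · simpa only [mul_comm (g _), IntegrableOn] using hi v hv.locallyIntegrable
      · intro x hx
        rw [image_eq_zero_of_notMem_tsupport fun h => hx (hgs h), zero_smul]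
  filter_upwards [this] with x hx hx'
  exact sub_eq_zero.1 (hx hx')

/-! ### Absolute convergence of the double integrals -/

theorem integrable_mul_truncKernel_sub {a b : ℝ} {α : ℝ} (hα1 : α < 1) (L : ℝ) {u : ℝ → ℝ}
    (hu : IntegrableOn u (Ioo a b)) :
    Integrable (fun p : ℝ × ℝ => (Ioo a b).indicator u p.2 * truncKernel α L (p.1 - p.2))
      (volume.prod volume) :=
  ((integrable_indicator_iff measurableSet_Ioo).2 hu).convolution_integrand
    (ContinuousLinearMap.mul ℝ ℝ) (integrable_truncKernel hα1 L)

/-- Almost every slice of the integrand of an L¹ convolution is integrable; cutting the kernel at `b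
- a` changes nothing inside (a, b). -/
theorem ae_integrableOn_leftRLIntegrand {a b σ : ℝ} (hσ : 0 < σ) {u : ℝ → ℝ}
    (hu : IntegrableOn u (Ioo a b)) :
    ∀ᵐ x ∂volume.restrict (Ioo a b), IntegrableOn (leftRLIntegrand σ u x) (Ioo a x) := by
  rw [ae_restrict_iff' measurableSet_Ioo]
  filter_upwards [(integrable_mul_truncKernel_sub (α := 1 - σ) (by linarith) (b - a)
    hu).prod_right_ae] with x hx hxab
  refine IntegrableOn.congr_fun hx.integrableOn (fun y hy => ?_) measurableSet_Ioo
  have h1 : y ∈ Ioo a b := ⟨hy.1, hy.2.trans hxab.2⟩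
  have h2 : x - y ∈ Ioo 0 (b - a) := ⟨sub_pos.2 hy.2, by linarith [hy.1, hxab.2]⟩
  simp only [indicator_of_mem h1, truncKernel, indicator_of_mem h2, leftRLIntegrand,
    Real.rpow_neg h2.1.le, div_eq_mul_inv]

/-- Integrand of the commutator of a fractional derivative with multiplication by `ψ`. -/
noncomputable def commIntegrand (α : ℝ) (u ψ : ℝ → ℝ) (x y : ℝ) : ℝ :=
  u y * (ψ x - ψ y) / (x - y) ^ (1 + α)

/-- The first coordinate is the evaluation point x, the second the integration variable y. -/
def ordTriangle (a b : ℝ) : Set (ℝ × ℝ) := {p | a < p.2 ∧ p.2 < p.1 ∧ p.1 < b}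

theorem isOpen_ordTriangle (a b : ℝ) : IsOpen (ordTriangle a b) :=
  (isOpen_lt continuous_const continuous_snd).inter
    ((isOpen_lt continuous_snd continuous_fst).inter (isOpen_lt continuous_fst continuous_const))

/-- On the triangle the integrand is the difference quotient of `ψ`, bounded by its Lipschitz
constant, times the integrable u(y) (x - y)^(-α). -/
theorem integrable_commIntegrand {a b α : ℝ} (hα1 : α < 1) {u ψ : ℝ → ℝ}
    (hu : IntegrableOn u (Ioo a b)) (hψ : ContDiffOn ℝ 1 ψ (Icc a b)) :
    Integrable ((ordTriangle a b).indicator fun p => commIntegrand α u ψ p.1 p.2)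
      (volume.prod volume) := by
  obtain ⟨K, hK⟩ := hψ.exists_lipschitzOnWith one_ne_zero (convex_Icc a b) isCompact_Icc
  have hT := (isOpen_ordTriangle a b).measurableSet
  have hcont : ContinuousOn (fun p : ℝ × ℝ => (ψ p.1 - ψ p.2) / (p.1 - p.2)) (ordTriangle a b) := by
    have h1 : ContinuousOn (fun p : ℝ × ℝ => ψ p.1) (ordTriangle a b) :=
      hψ.continuousOn.comp continuousOn_fst fun p hp =>
        ⟨(hp.1.trans hp.2.1).le, hp.2.2.le⟩
    have h2 : ContinuousOn (fun p : ℝ × ℝ => ψ p.2) (ordTriangle a b) :=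
      hψ.continuousOn.comp continuousOn_snd fun p hp =>
        ⟨hp.1.le, (hp.2.1.trans hp.2.2).le⟩
    exact (h1.sub h2).div (continuousOn_fst.sub continuousOn_snd) fun p hp =>
      (sub_pos.2 hp.2.1).ne'
  have hb := (integrable_mul_truncKernel_sub hα1 (b - a) hu).bdd_mul (c := (K : ℝ))
    ((aestronglyMeasurable_indicator_iff hT).2 (hcont.aestronglyMeasurable hT)) (ae_of_all _ fun p => ?_)
  · refine hb.congr (ae_of_all _ fun p => ?_)
    by_cases hp : p ∈ ordTriangle a b
    · have h1 : p.2 ∈ Ioo a b := ⟨hp.1, hp.2.1.trans hp.2.2⟩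
      have h2 : p.1 - p.2 ∈ Ioo 0 (b - a) := ⟨sub_pos.2 hp.2.1, by linarith [hp.1, hp.2.2]⟩
      have h3 := (Real.rpow_pos_of_pos h2.1 α).ne'
      have h4 := h2.1.ne'
      simp only [indicator_of_mem hp, indicator_of_mem h1, truncKernel, indicator_of_mem h2,
        commIntegrand, Real.rpow_neg h2.1.le, Real.rpow_add h2.1, Real.rpow_one]
      field_simp
    · simp only [indicator_of_notMem hp, zero_mul]
  · by_cases hp : p ∈ ordTriangle a b
    · rw [indicator_of_mem hp, norm_div, div_le_iff₀ (norm_pos_iff.2 (sub_pos.2 hp.2.1).ne')]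
      exact hK.norm_sub_le ⟨(hp.1.trans hp.2.1).le, hp.2.2.le⟩ ⟨hp.1.le, (hp.2.1.trans hp.2.2).le⟩
    · rw [indicator_of_notMem hp, norm_zero]
      exact K.2

theorem indicator_ordTriangle_commIntegrand {a b α : ℝ} (u ψ : ℝ → ℝ) {x : ℝ} (hx : x ∈ Ioo a b) :
    (fun y => (ordTriangle a b).indicator (fun p => commIntegrand α u ψ p.1 p.2) (x, y)) =
      (Ioo a x).indicator (commIntegrand α u ψ x) := by
  ext y
  by_cases hy : y ∈ Ioo a x
  · have h1 : (x, y) ∈ ordTriangle a b := ⟨hy.1, hy.2, hx.2⟩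
    simp only [indicator_of_mem hy, indicator_of_mem h1]
  · have h1 : (x, y) ∉ ordTriangle a b := fun h => hy ⟨h.1, h.2.1⟩
    simp only [indicator_of_notMem hy, indicator_of_notMem h1]

theorem integrableOn_integral_commIntegrand {a b α : ℝ} (hα1 : α < 1) {u ψ : ℝ → ℝ}
    (hu : IntegrableOn u (Ioo a b)) (hψ : ContDiffOn ℝ 1 ψ (Icc a b)) :
    IntegrableOn (fun x => ∫ y in Ioo a x, commIntegrand α u ψ x y) (Ioo a b) := by
  refine (integrable_commIntegrand hα1 hu hψ).integral_prod_left.integrableOn.congr_fun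
    (fun x hx => ?_) measurableSet_Ioo
  simp only [indicator_ordTriangle_commIntegrand u ψ hx]
  exact integral_indicator measurableSet_Ioo

theorem ae_integrableOn_commIntegrand {a b α : ℝ} (hα1 : α < 1) {u ψ : ℝ → ℝ}
    (hu : IntegrableOn u (Ioo a b)) (hψ : ContDiffOn ℝ 1 ψ (Icc a b)) :
    ∀ᵐ x ∂volume.restrict (Ioo a b), IntegrableOn (commIntegrand α u ψ x) (Ioo a x) := by
  rw [ae_restrict_iff' measurableSet_Ioo]
  filter_upwards [(integrable_commIntegrand hα1 hu hψ).prod_right_ae] with x hx hxab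
  rw [indicator_ordTriangle_commIntegrand u ψ hxab] at hx
  exact (integrable_indicator_iff measurableSet_Ioo).1 hx

/-! ### The commutator with multiplication by `ψ` -/

theorem Real.Gamma_one_sub_eq {α : ℝ} (hα0 : α ≠ 0) :
    Real.Gamma (1 - α) = -α * Real.Gamma (-α) := by
  rw [sub_eq_neg_add, Real.Gamma_add_one (neg_ne_zero.2 hα0)]

theorem contDiff_one_mul_of_tsupport {a b : ℝ} {ψ φ : ℝ → ℝ} (hψ : ContDiffOn ℝ 1 ψ (Icc a b))
    (hφ : ContDiff ℝ 1 φ) (hs : tsupport φ ⊆ Ioo a b) : ContDiff ℝ 1 (fun x => ψ x * φ x) := by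
  rw [contDiff_iff_contDiffAt]
  intro x
  by_cases hx : x ∈ tsupport φ
  · exact (hψ.contDiffAt (Icc_mem_nhds (hs hx).1 (hs hx).2)).mul hφ.contDiffAt
  · refine (contDiffAt_const (c := (0 : ℝ))).congr_of_eventuallyEq ?_
    filter_upwards [notMem_tsupport_iff_eventuallyEq.1 hx] with z hz
    rw [hz, Pi.zero_apply, mul_zero]

/-- The commutator of the right Liouville derivative with multiplication by `ψ`. -/
theorem rightLiouvilleDeriv_mul_sub {a b α : ℝ} (hα0 : 0 < α) (hα1 : α < 1) {ψ φ : ℝ → ℝ}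
    (hψ : ContDiffOn ℝ 1 ψ (Icc a b)) (hφ : ContDiff ℝ 1 φ) (hφc : HasCompactSupport φ)
    (hs : tsupport φ ⊆ Ioo a b) (y : ℝ) :
    rightLiouvilleDeriv α (fun x => ψ x * φ x) y - ψ y * rightLiouvilleDeriv α φ y =
      1 / Real.Gamma (-α) * ∫ x in Ioi y, (ψ x - ψ y) * φ x / (x - y) ^ (1 + α) := by
  have hg := contDiff_one_mul_of_tsupport hψ hφ hs
  have hgc : HasCompactSupport (fun x => ψ x * φ x) := hφc.mul_left
  have hhc : HasCompactSupport (fun x => (ψ x - ψ y) * φ x) := hφc.mul_left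
  have hh : ContDiff ℝ 1 (fun x => (ψ x - ψ y) * φ x) := by
    simp only [sub_mul]
    exact hg.sub (contDiff_const.mul hφ)
  have hd : ∀ x, deriv (fun x => (ψ x - ψ y) * φ x) x =
      deriv (fun x => ψ x * φ x) x - ψ y * deriv φ x := by
    intro x
    simp only [sub_mul]
    rw [deriv_fun_sub (hg.differentiable one_ne_zero x)
      ((hφ.differentiable one_ne_zero x).const_mul _), deriv_const_mul_field]
  -- With `y` frozen, `ψ y` is a constant, so the derivative of the product vanishing at `y`
  -- combines the two derivatives in the commutator.
  have ibp := (integral_deriv_div_sub_rpow hα1 hh hhc (y := y) (by simp)).2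
  simp only [hd, sub_div, mul_div_assoc] at ibp
  rw [integral_sub (integrableOn_div_sub_rpow hα1 (hg.continuous_deriv le_rfl) hgc.deriv y)
    ((integrableOn_div_sub_rpow hα1 (hφ.continuous_deriv le_rfl) hφc.deriv y).const_mul _),
    integral_const_mul] at ibp
  rw [rightLiouvilleDeriv_eq hα1 hg hgc, rightLiouvilleDeriv_eq hα1 hφ hφc,
    show ∀ c A B : ℝ, -c * A - ψ y * (-c * B) = -(c * (A - ψ y * B)) by intros; ring, ibp,
    Real.Gamma_one_sub_eq hα0.ne']
  simp only [mul_div_assoc]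
  -- If Γ(-α) were 0, both sides would be 0 because 1 / 0 = 0; nonvanishing is not needed here.
  rcases eq_or_ne (Real.Gamma (-α)) 0 with h0 | h0
  · simp [h0]
  · field_simp

/-- The weak derivative of a product, with the correction term as one singular integral. -/
theorem IsLeftWeakFracDeriv.mul {a b α : ℝ} (hα0 : 0 < α) (hα1 : α < 1) {u v ψ : ℝ → ℝ}
    (hψ : ContDiffOn ℝ 1 ψ (Icc a b)) (h : IsLeftWeakFracDeriv a b α u v) :
    IsLeftWeakFracDeriv a b α (fun x => u x * ψ x)
      (fun x => v x * ψ x - 1 / Real.Gamma (-α) * ∫ y in Ioo a x, commIntegrand α u ψ x y) := by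
  have hI : LocallyIntegrableOn (fun x => v x * ψ x) (Ioo a b) :=
    h.locallyIntegrable.mul_continuousOn (hψ.continuousOn.mono Ioo_subset_Icc_self)
      isOpen_Ioo.isLocallyClosed
  have hQ := (integrableOn_integral_commIntegrand hα1 h.integrable hψ).const_mul
    (1 / Real.Gamma (-α))
  have huψ : IntegrableOn (fun x => u x * ψ x) (Ioo a b) :=
    h.integrable.mul_continuousOn_of_subset hψ.continuousOn measurableSet_Ioo isCompact_Icc
      Ioo_subset_Icc_self
  refine ⟨huψ, hI.sub (IntegrableOn.locallyIntegrableOn hQ), fun φ hφ => ?_⟩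
  have hφ1 : ContDiff ℝ 1 φ := hφ.smooth.of_le (by exact_mod_cast le_top)
  have hg := contDiff_one_mul_of_tsupport hψ hφ1 hφ.support
  have hgc : HasCompactSupport (fun x => ψ x * φ x) := hφ.compact.mul_left
  have hgs : tsupport (fun x => ψ x * φ x) ⊆ Ioo a b := (tsupport_mul_subset_right).trans hφ.support
  obtain ⟨C, hC⟩ := hφ.compact.exists_bound_of_continuous hφ1.continuous
  have hF : Integrable (fun p : ℝ × ℝ =>
      (ordTriangle a b).indicator (fun p => commIntegrand α u ψ p.1 p.2) p * φ p.1)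
      (volume.prod volume) :=
    (integrable_commIntegrand hα1 h.integrable hψ).mul_bdd (c := C)
      (hφ1.continuous.comp continuous_fst).aestronglyMeasurable (ae_of_all _ fun p => hC p.1)
  have fub := integral_integral_swap (f := fun x y : ℝ =>
      (ordTriangle a b).indicator (fun p => commIntegrand α u ψ p.1 p.2) (x, y) * φ x)
      (μ := volume) (ν := volume) hF
  have lhs : (∫ x, ∫ y, (ordTriangle a b).indicator (fun p => commIntegrand α u ψ p.1 p.2) (x, y)
      * φ x) = ∫ x in Ioo a b, (∫ y in Ioo a x, commIntegrand α u ψ x y) * φ x := by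
    rw [← setIntegral_eq_integral_of_forall_compl_eq_zero (s := Ioo a b)]
    · refine setIntegral_congr_fun measurableSet_Ioo fun x hx => ?_
      simp only [integral_mul_const, indicator_ordTriangle_commIntegrand u ψ hx,
        integral_indicator measurableSet_Ioo]
    · intro x hx
      simp [eq_zero_of_notMem_tsupport hφ.support hx]
  have rhs : (∫ y, ∫ x, (ordTriangle a b).indicator (fun p => commIntegrand α u ψ p.1 p.2) (x, y)
      * φ x) = ∫ y in Ioo a b, u y *
        ∫ x in Ioi y, (ψ x - ψ y) * φ x / (x - y) ^ (1 + α) := by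
    rw [← integral_indicator measurableSet_Ioo]
    refine integral_congr_ae (ae_of_all _ fun y => ?_)
    by_cases hy : y ∈ Ioo a b
    · simp only [indicator_of_mem hy]
      rw [← integral_indicator measurableSet_Ioi, ← integral_const_mul]
      refine integral_congr_ae (ae_of_all _ fun x => ?_)
      -- The inner integral runs over all x > y, but `φ` vanishes for x ≥ b, so only the triangle
      -- contributes.
      by_cases hx : y < x ∧ x < b
      · have h1 : (x, y) ∈ ordTriangle a b := ⟨hy.1, hx⟩
        simp only [indicator_of_mem h1, indicator_of_mem (show x ∈ Ioi y from hx.1), commIntegrand]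
        ring
      · have h1 : (x, y) ∉ ordTriangle a b := fun h => hx h.2
        simp only [indicator_of_notMem h1, zero_mul]
        by_cases hxy : x ∈ Ioi y
        · have h2 : φ x = 0 := eq_zero_of_notMem_tsupport hφ.support fun h => hx ⟨hxy, h.2⟩
          simp [h2]
        · simp only [indicator_of_notMem hxy, mul_zero]
    · have h1 : ∀ x, (x, y) ∉ ordTriangle a b := fun x h => hy ⟨h.1, h.2.1.trans h.2.2⟩
      simp [indicator_of_notMem hy, indicator_of_notMem (h1 _)]
  rw [lhs, rhs] at fub
  have hv : ∫ x in Ioo a b, v x * (ψ x * φ x) =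
      ∫ x in Ioo a b, u x * rightLiouvilleDeriv α (fun x => ψ x * φ x) x :=
    h.integral_eq_of_contDiff_one hα1 hg hgc hgs
  have i1 := integrableOn_mul_rightLiouvilleDeriv hα1 h.integrable hg hgc hgs
  have i2 := integrableOn_mul_rightLiouvilleDeriv hα1 huψ hφ1 hφ.compact hφ.support
  have e1 : (∫ x in Ioo a b, u x * rightLiouvilleDeriv α (fun x => ψ x * φ x) x) -
      ∫ x in Ioo a b, u x * ψ x * rightLiouvilleDeriv α φ x = 1 / Real.Gamma (-α) *
        ∫ y in Ioo a b, u y * ∫ x in Ioi y, (ψ x - ψ y) * φ x / (x - y) ^ (1 + α) := by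
    rw [← integral_sub i1 i2, ← integral_const_mul]
    refine integral_congr_ae (ae_of_all _ fun y => ?_)
    simp only
    rw [mul_left_comm, ← rightLiouvilleDeriv_mul_sub hα0 hα1 hψ hφ1 hφ.compact hφ.support]
    ring
  have i3 : IntegrableOn (fun x => v x * (ψ x * φ x)) (Ioo a b) := by
    refine IntegrableOn.of_forall_sdiff_eq_zero (s := tsupport φ) ?_ measurableSet_Ioo
      fun x hx => by rw [image_eq_zero_of_notMem_tsupport hx.2, mul_zero, mul_zero]
    exact (h.locallyIntegrable.integrableOn_compact_subset hφ.support hφ.compact.isCompact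
      ).mul_continuousOn hg.continuous.continuousOn hφ.compact.isCompact
  have i4 : IntegrableOn (fun x => 1 / Real.Gamma (-α) *
      (∫ y in Ioo a x, commIntegrand α u ψ x y) * φ x) (Ioo a b) :=
    Integrable.mul_bdd (c := C) hQ hφ1.continuous.aestronglyMeasurable (ae_of_all _ hC)
  have e2 : ∫ x in Ioo a b, (v x * ψ x - 1 / Real.Gamma (-α) *
      ∫ y in Ioo a x, commIntegrand α u ψ x y) * φ x =
      (∫ x in Ioo a b, v x * (ψ x * φ x)) - 1 / Real.Gamma (-α) *
        ∫ x in Ioo a b, (∫ y in Ioo a x, commIntegrand α u ψ x y) * φ x := by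
    rw [← integral_const_mul]
    simp only [← mul_assoc] at i3 i4 ⊢
    rw [← integral_sub i3 i4]
    simp only [sub_mul]
  rw [e2, hv, fub, ← e1, sub_sub_cancel]

/-! ### Taylor expansion of the commutator and the Gamma factors -/

/-- Taylor's formula on [y, x] produces derivatives within that interval; this makes them
independent of y. -/
theorem derivOn_eq_of_subset {a b x y : ℝ} (hxy : y < x) (hs : Icc y x ⊆ Icc a b) {k : ℕ}
    {ψ : ℝ → ℝ} (hψ : ContDiffOn ℝ k ψ (Icc a b)) {z : ℝ} (hz : z ∈ Icc y x) :
    iteratedDerivWithin k ψ (Icc y x) z = derivOn a b k ψ z := by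
  have hab : a < b := (hs (left_mem_Icc.2 hxy.le)).1.trans_lt
    (hxy.trans_le (hs (right_mem_Icc.2 hxy.le)).2)
  rw [derivOn, iteratedDerivWithin, iteratedDerivWithin, iteratedFDerivWithin_subset hs
    (uniqueDiffOn_Icc hxy) (uniqueDiffOn_Icc hab) hψ hz]

/-- Taylor expansion of `ψ` around `x`, evaluated to the left of `x`. -/
theorem sub_eq_taylor_left {a b x y : ℝ} (hy : a < y) (hxy : y < x) (hx : x < b) {m : ℕ}
    {ψ : ℝ → ℝ} (hψ : ContDiffOn ℝ (m + 1 : ℕ) ψ (Icc a b)) :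
    ψ x - ψ y = (∑ k ∈ Finset.Icc 1 m,
        -((-1) ^ k / k.factorial * derivOn a b k ψ x) * (x - y) ^ k) +
      (-1) ^ m / m.factorial * ∫ z in y..x, derivOn a b (m + 1) ψ z * (z - y) ^ m := by
  have hs : Icc y x ⊆ Icc a b := Icc_subset_Icc hy.le hx.le
  have hT := taylor_integral_remainder (f := ψ) (x := y) (x₀ := x) (n := m)
    (by rw [uIcc_of_ge hxy.le]; exact hψ.mono hs)
  rw [uIcc_of_ge hxy.le, taylor_within_apply] at hT
  have e1 : ∀ k ∈ Finset.range (m + 1), ((k.factorial : ℝ)⁻¹ * (y - x) ^ k) •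
      iteratedDerivWithin k ψ (Icc y x) x =
      ((-1) ^ k / k.factorial * derivOn a b k ψ x) * (x - y) ^ k := by
    intro k hk
    rw [derivOn_eq_of_subset hxy hs (hψ.of_le (by
      exact_mod_cast (Finset.mem_range.1 hk).le)) (right_mem_Icc.2 hxy.le),
      ← neg_sub x y, neg_pow, smul_eq_mul]
    ring
  have e2 : (∫ t in x..y, ((y - t) ^ m / (m.factorial : ℝ)) •
      iteratedDerivWithin (m + 1) ψ (Icc y x) t) =
      -((-1) ^ m / m.factorial * ∫ z in y..x, derivOn a b (m + 1) ψ z * (z - y) ^ m) := by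
    rw [intervalIntegral.integral_symm, ← intervalIntegral.integral_const_mul]
    congr 1
    refine intervalIntegral.integral_congr fun z hz => ?_
    rw [uIcc_of_le hxy.le] at hz
    rw [derivOn_eq_of_subset hxy hs hψ hz, ← neg_sub z y, neg_pow, smul_eq_mul]
    ring
  rw [Finset.sum_congr rfl e1, e2, Finset.range_eq_Ico, Finset.sum_eq_sum_Ico_succ_bot (by omega)]
    at hT
  simp only [pow_zero, Nat.factorial_zero, Nat.cast_one, div_one, one_mul, mul_one, zero_add,
    derivOn, iteratedDerivWithin_zero] at hT
  have e3 : Finset.Icc 1 m = Finset.Ico 1 (m + 1) := by ext; simp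
  rw [e3]
  simp only [neg_mul, Finset.sum_neg_distrib, derivOn]
  linarith

theorem commIntegrand_eq {a b α x y : ℝ} (hy : a < y) (hxy : y < x) (hx : x < b) {m : ℕ}
    (u : ℝ → ℝ) {ψ : ℝ → ℝ} (hψ : ContDiffOn ℝ (m + 1 : ℕ) ψ (Icc a b)) :
    commIntegrand α u ψ x y = (∑ k ∈ Finset.Icc 1 m,
        -((-1) ^ k / k.factorial * derivOn a b k ψ x) * leftRLIntegrand (k - α) u x y) +
      (-1) ^ m / m.factorial * leftRemainderIntegrand a b α m u ψ x y := by
  have h0 : 0 < x - y := sub_pos.2 hxy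
  rw [commIntegrand, sub_eq_taylor_left hy hxy hx hψ, leftRemainderIntegrand, mul_add, add_div,
    Finset.mul_sum, Finset.sum_div]
  refine congrArg₂ _ (Finset.sum_congr rfl fun k _ => ?_) (by ring)
  rw [leftRLIntegrand, show 1 - ((k : ℝ) - α) = (1 + α) - k by ring, Real.rpow_sub h0,
    Real.rpow_natCast]
  have h1 := (Real.rpow_pos_of_pos h0 (1 + α)).ne'
  have h2 := (pow_pos h0 k).ne'
  field_simp

/-- By Γ(s + 1) = s Γ(s), passing from k to k + 1 trades a factor α - k for k - α, hence one sign.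
-/
theorem Gamma_reflection_shift {α : ℝ} (hα0 : 0 < α) (hα1 : α < 1) (k : ℕ) :
    Real.Gamma (1 + α) * Real.Gamma (-α) =
      (-1) ^ k * (Real.Gamma (1 - k + α) * Real.Gamma (k - α)) := by
  induction k with
  | zero => simp
  | succ k ih =>
    have hk : (k : ℝ) - α ≠ 0 := by
      rcases k.eq_zero_or_pos with rfl | h
      · simpa using hα0.ne'
      · have : (1 : ℝ) ≤ k := by exact_mod_cast h
        exact (by linarith : (0 : ℝ) < k - α).ne'
    have hk' : α - (k : ℝ) ≠ 0 := fun h => hk (by linarith)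
    rw [ih, show 1 - (k : ℝ) + α = (α - k) + 1 by ring, Real.Gamma_add_one hk',
      show ((k + 1 : ℕ) : ℝ) - α = (k - α) + 1 by push_cast; ring, Real.Gamma_add_one hk,
      show 1 - ((k + 1 : ℕ) : ℝ) + α = α - k by push_cast; ring]
    ring

theorem Gamma_neg_ne_zero {α : ℝ} (hα0 : 0 < α) (hα1 : α < 1) : Real.Gamma (-α) ≠ 0 := by
  refine fun h => (Real.Gamma_pos_of_pos (sub_pos.2 hα1)).ne' ?_
  rw [Real.Gamma_one_sub_eq hα0.ne', h, mul_zero]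

theorem fracBinom_mul_one_div_Gamma {α : ℝ} (hα0 : 0 < α) (hα1 : α < 1) (k : ℕ) :
    fracBinom α k * (1 / Real.Gamma (k - α)) =
      (-1) ^ k / k.factorial * (1 / Real.Gamma (-α)) := by
  have hR := Gamma_reflection_shift hα0 hα1 k
  have h1 : Real.Gamma (1 + α) ≠ 0 := (Real.Gamma_pos_of_pos (by linarith)).ne'
  have h2 := Gamma_neg_ne_zero hα0 hα1
  have h3 := mul_ne_zero h1 h2
  -- Γ(1 - k + α) and Γ(k - α) are nonzero because their product is, up to sign, Γ(1 + α) Γ(-α).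
  rw [hR] at h3
  have h4 := right_ne_zero_of_mul h3
  have h5 := left_ne_zero_of_mul h4
  have h6 := right_ne_zero_of_mul h4
  have h7 : (k.factorial : ℝ) ≠ 0 := by exact_mod_cast k.factorial_ne_zero
  rw [fracBinom, add_comm (1 : ℝ) k, Real.Gamma_nat_eq_factorial]
  field_simp
  linear_combination hR

/-! ### The left product rule -/

theorem leftProductRule {a b α : ℝ} (hα0 : 0 < α) (hα1 : α < 1) {m : ℕ} {ψ : ℝ → ℝ}
    (hψ : ContDiffOn ℝ (m + 1 : ℕ) ψ (Icc a b)) {u v : ℝ → ℝ} (h : IsLeftWeakFracDeriv a b α u v) :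
    (∃ w, IsLeftWeakFracDeriv a b α (fun x => u x * ψ x) w) ∧
      (∀ w, IsLeftWeakFracDeriv a b α (fun x => u x * ψ x) w →
        ∀ᵐ x ∂(volume.restrict (Ioo a b)),
          (∀ k ∈ Finset.Icc 1 m, IntegrableOn (leftRLIntegrand (k - α) u x) (Ioo a x)) ∧
          IntegrableOn (leftRemainderIntegrand a b α m u ψ x) (Ioo a x) ∧
          w x = v x * ψ x
            + ∑ k ∈ Finset.Icc 1 m,
                fracBinom α k * leftRLIntegral a (k - α) u x * derivOn a b k ψ x
            + leftRemainder a b α m u ψ x) := by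
  have hψ1 : ContDiffOn ℝ 1 ψ (Icc a b) := hψ.of_le (by exact_mod_cast Nat.le_add_left 1 m)
  have hw := h.mul hα0 hα1 hψ1
  refine ⟨⟨_, hw⟩, fun w hw' => ?_⟩
  have hRL : ∀ᵐ x ∂volume.restrict (Ioo a b), ∀ k ∈ Finset.Icc 1 m,
      IntegrableOn (leftRLIntegrand (k - α) u x) (Ioo a x) := by
    rw [Finset.eventually_all]
    intro k hk
    have : (1 : ℝ) ≤ k := by exact_mod_cast (Finset.mem_Icc.1 hk).1
    exact ae_integrableOn_leftRLIntegrand (by linarith) h.integrable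
  filter_upwards [hw.ae_eq hw', hRL, ae_integrableOn_commIntegrand hα1 h.integrable hψ1,
    ae_restrict_mem measurableSet_Ioo] with x hx hxRL hxc hxab
  have hsum : IntegrableOn (fun y => ∑ k ∈ Finset.Icc 1 m,
      -((-1) ^ k / k.factorial * derivOn a b k ψ x) * leftRLIntegrand (k - α) u x y) (Ioo a x) :=
    integrable_finsetSum _ fun k hk => (hxRL k hk).const_mul _
  have hm : ((-1) ^ m / m.factorial : ℝ) ≠ 0 :=
    div_ne_zero (pow_ne_zero _ (by norm_num)) (by exact_mod_cast m.factorial_ne_zero)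
  have hcomm : EqOn (commIntegrand α u ψ x) (fun y => (∑ k ∈ Finset.Icc 1 m,
      -((-1) ^ k / k.factorial * derivOn a b k ψ x) * leftRLIntegrand (k - α) u x y) +
      (-1) ^ m / m.factorial * leftRemainderIntegrand a b α m u ψ x y) (Ioo a x) :=
    fun y hy => commIntegrand_eq hy.1 hy.2 hxab.2 u hψ
  -- No separate estimate of the remainder is needed: up to a nonzero constant it is the commutator
  -- minus the Taylor terms, all integrable.
  have hrem : IntegrableOn (leftRemainderIntegrand a b α m u ψ x) (Ioo a x) := by
    refine IntegrableOn.congr_fun ((hxc.sub hsum).const_mul ((-1) ^ m / m.factorial : ℝ)⁻¹)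
      (fun y hy => ?_) measurableSet_Ioo
    simp only [Pi.sub_apply]
    rw [hcomm hy]
    field_simp
    ring
  refine ⟨hxRL, hrem, ?_⟩
  rw [hx, setIntegral_congr_fun measurableSet_Ioo hcomm, integral_add hsum (hrem.const_mul _),
    integral_finsetSum _ fun k hk => (hxRL k hk).const_mul _]
  simp only [integral_const_mul]
  have e : ∀ k ∈ Finset.Icc 1 m, fracBinom α k * leftRLIntegral a (k - α) u x * derivOn a b k ψ x =
      -(1 / Real.Gamma (-α) * (-((-1) ^ k / k.factorial * derivOn a b k ψ x) *
        ∫ y in Ioo a x, leftRLIntegrand (k - α) u x y)) := by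
    intro k _
    rw [leftRLIntegral, ← mul_assoc, fracBinom_mul_one_div_Gamma hα0 hα1]
    ring
  rw [Finset.sum_congr rfl e, leftRemainder, Finset.sum_neg_distrib, ← Finset.mul_sum]
  ring

/-! ### Reflection x ↦ -x and the right product rule -/

theorem preimage_neg_Ioo' (c d : ℝ) : (fun x : ℝ => -x) ⁻¹' Ioo c d = Ioo (-d) (-c) := by
  ext; simp [and_comm]

theorem setIntegral_comp_neg_preimage (f : ℝ → ℝ) (s : Set ℝ) :
    ∫ x in (fun x : ℝ => -x) ⁻¹' s, f (-x) = ∫ x in s, f x :=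
  (Measure.measurePreserving_neg (volume : Measure ℝ)).setIntegral_preimage_emb
    (MeasurableEquiv.neg ℝ).measurableEmbedding f s

theorem setIntegral_Ioo_comp_neg (f : ℝ → ℝ) (c d : ℝ) :
    ∫ x in Ioo (-d) (-c), f (-x) = ∫ x in Ioo c d, f x := by
  rw [← preimage_neg_Ioo', setIntegral_comp_neg_preimage]

theorem integrableOn_comp_neg_preimage {f : ℝ → ℝ} {s : Set ℝ} :
    IntegrableOn (fun x => f (-x)) ((fun x : ℝ => -x) ⁻¹' s) ↔ IntegrableOn f s :=
  (Measure.measurePreserving_neg (volume : Measure ℝ)).integrableOn_comp_preimage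
    (MeasurableEquiv.neg ℝ).measurableEmbedding

theorem integrableOn_Ioo_comp_neg {f : ℝ → ℝ} {c d : ℝ} :
    IntegrableOn (fun x => f (-x)) (Ioo (-d) (-c)) ↔ IntegrableOn f (Ioo c d) := by
  rw [← preimage_neg_Ioo', integrableOn_comp_neg_preimage]

theorem locallyIntegrableOn_Ioo_comp_neg {f : ℝ → ℝ} {c d : ℝ}
    (hf : LocallyIntegrableOn f (Ioo c d)) :
    LocallyIntegrableOn (fun x => f (-x)) (Ioo (-d) (-c)) := by
  rw [locallyIntegrableOn_iff isOpen_Ioo.isLocallyClosed] at hf ⊢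
  intro K hK hKc
  have := hf ((fun x => -x) ⁻¹' K) (fun x hx => by
    have := hK hx
    exact ⟨by linarith [this.2], by linarith [this.1]⟩)
    ((Homeomorph.neg ℝ).isCompact_preimage.2 hKc)
  rw [← integrableOn_comp_neg_preimage] at this
  simpa only [preimage_preimage, neg_neg, preimage_id'] using this

theorem IsTestFunction.comp_neg {a b : ℝ} {φ : ℝ → ℝ} (h : IsTestFunction a b φ) :
    IsTestFunction (-b) (-a) (fun x => φ (-x)) := by
  refine ⟨h.smooth.comp contDiff_neg, h.compact.comp_homeomorph (Homeomorph.neg ℝ), ?_⟩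
  rw [← preimage_neg_Ioo']
  exact (tsupport_comp_subset_preimage φ continuous_neg).trans (preimage_mono h.support)

theorem leftLiouvilleDeriv_eq_comp_neg (α : ℝ) (φ : ℝ → ℝ) (x : ℝ) :
    leftLiouvilleDeriv α φ x = rightLiouvilleDeriv α (fun t => φ (-t)) (-x) := by
  rw [leftLiouvilleDeriv, rightLiouvilleDeriv, ← deriv_comp_neg (f := fun t =>
    1 / Real.Gamma (1 - α) * ∫ y in Ioi t, φ (-y) / (y - t) ^ α)]
  congr 1
  ext t
  congr 1
  rw [show Iio t = (fun x : ℝ => -x) ⁻¹' Ioi (-t) by ext; simp,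
    ← setIntegral_comp_neg_preimage (fun y => φ (-y) / (y - -t) ^ α)]
  simp only [neg_neg, sub_neg_eq_add, neg_add_eq_sub]

theorem rightLiouvilleDeriv_eq_comp_neg (α : ℝ) (φ : ℝ → ℝ) (x : ℝ) :
    rightLiouvilleDeriv α φ x = leftLiouvilleDeriv α (fun t => φ (-t)) (-x) := by
  simp only [leftLiouvilleDeriv_eq_comp_neg, neg_neg]

theorem IsRightWeakFracDeriv.comp_neg {a b α : ℝ} {u v : ℝ → ℝ}
    (h : IsRightWeakFracDeriv a b α u v) :
    IsLeftWeakFracDeriv (-b) (-a) α (fun x => u (-x)) (fun x => v (-x)) := by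
  refine ⟨integrableOn_Ioo_comp_neg.2 h.integrable, locallyIntegrableOn_Ioo_comp_neg h.locallyIntegrable,
    fun φ hφ => ?_⟩
  have hφ' := hφ.comp_neg
  rw [neg_neg, neg_neg] at hφ'
  have e := h.integral_eq _ hφ'
  rw [← setIntegral_Ioo_comp_neg, ← setIntegral_Ioo_comp_neg (fun x => u x * _)] at e
  simpa only [neg_neg, leftLiouvilleDeriv_eq_comp_neg] using e

theorem IsLeftWeakFracDeriv.comp_neg {a b α : ℝ} {u v : ℝ → ℝ}
    (h : IsLeftWeakFracDeriv a b α u v) :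
    IsRightWeakFracDeriv (-b) (-a) α (fun x => u (-x)) (fun x => v (-x)) := by
  refine ⟨integrableOn_Ioo_comp_neg.2 h.integrable, locallyIntegrableOn_Ioo_comp_neg h.locallyIntegrable,
    fun φ hφ => ?_⟩
  have hφ' := hφ.comp_neg
  rw [neg_neg, neg_neg] at hφ'
  have e := h.integral_eq _ hφ'
  rw [← setIntegral_Ioo_comp_neg, ← setIntegral_Ioo_comp_neg (fun x => u x * _)] at e
  simpa only [neg_neg, rightLiouvilleDeriv_eq_comp_neg] using e

theorem derivOn_comp_neg (a b : ℝ) (k : ℕ) (ψ : ℝ → ℝ) (x : ℝ) :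
    derivOn (-b) (-a) k (fun t => ψ (-t)) x = (-1) ^ k * derivOn a b k ψ (-x) := by
  rw [derivOn, iteratedDerivWithin_comp_neg, neg_Icc, neg_neg, neg_neg, smul_eq_mul, derivOn]

theorem leftRLIntegrand_comp_neg (σ : ℝ) (u : ℝ → ℝ) (x : ℝ) :
    leftRLIntegrand σ (fun t => u (-t)) (-x) = fun y => rightRLIntegrand σ u x (-y) := by
  ext y
  rw [leftRLIntegrand, rightRLIntegrand, show -x - y = -y - x by ring]

theorem leftRLIntegral_comp_neg (b σ : ℝ) (u : ℝ → ℝ) (x : ℝ) :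
    leftRLIntegral (-b) σ (fun t => u (-t)) (-x) = rightRLIntegral b σ u x := by
  rw [leftRLIntegral, rightRLIntegral, leftRLIntegrand_comp_neg, setIntegral_Ioo_comp_neg]

theorem leftRemainderIntegrand_comp_neg (a b α : ℝ) (m : ℕ) (u ψ : ℝ → ℝ) (x : ℝ) :
    leftRemainderIntegrand (-b) (-a) α m (fun t => u (-t)) (fun t => ψ (-t)) (-x) =
      fun y => (-1) ^ (m + 1) * rightRemainderIntegrand a b α m u ψ x (-y) := by
  ext y
  have e := intervalIntegral.integral_comp_neg (a := y) (b := -x)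
    (fun z => derivOn a b (m + 1) ψ z * (-y - z) ^ m)
  rw [neg_neg] at e
  rw [leftRemainderIntegrand, rightRemainderIntegrand, show -x - y = -y - x by ring, ← e,
    mul_left_comm, ← intervalIntegral.integral_const_mul ((-1) ^ (m + 1))]
  simp only [derivOn_comp_neg, sub_neg_eq_add, neg_add_eq_sub, mul_assoc]

theorem leftRemainder_comp_neg (a b α : ℝ) (m : ℕ) (u ψ : ℝ → ℝ) (x : ℝ) :
    leftRemainder (-b) (-a) α m (fun t => u (-t)) (fun t => ψ (-t)) (-x) =
      rightRemainder a b α m u ψ x := by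
  -- The sign from the reflected derivative of order m + 1 cancels the prefactor of the left
  -- remainder.
  rw [leftRemainder, rightRemainder, leftRemainderIntegrand_comp_neg, integral_const_mul,
    setIntegral_Ioo_comp_neg, ← mul_assoc, div_mul_eq_mul_div, ← mul_pow]
  norm_num

/-- The left rule is applied on (-b, -a) to the reflected functions; the signs (-1)^k come from the
chain rule for `ψ (-t)`. -/
theorem rightProductRule {a b α : ℝ} (hα0 : 0 < α) (hα1 : α < 1) {m : ℕ} {ψ : ℝ → ℝ}
    (hψ : ContDiffOn ℝ (m + 1 : ℕ) ψ (Icc a b)) {u v : ℝ → ℝ} (h : IsRightWeakFracDeriv a b α u v) :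
    (∃ w, IsRightWeakFracDeriv a b α (fun x => u x * ψ x) w) ∧
      (∀ w, IsRightWeakFracDeriv a b α (fun x => u x * ψ x) w →
        ∀ᵐ x ∂(volume.restrict (Ioo a b)),
          (∀ k ∈ Finset.Icc 1 m, IntegrableOn (rightRLIntegrand (k - α) u x) (Ioo x b)) ∧
          IntegrableOn (rightRemainderIntegrand a b α m u ψ x) (Ioo x b) ∧
          w x = v x * ψ x
            + ∑ k ∈ Finset.Icc 1 m,
                (-1) ^ k * fracBinom α k * rightRLIntegral b (k - α) u x * derivOn a b k ψ x
            + rightRemainder a b α m u ψ x) := by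
  have hψ' : ContDiffOn ℝ (m + 1 : ℕ) (fun t => ψ (-t)) (Icc (-b) (-a)) :=
    hψ.comp contDiff_neg.contDiffOn fun x hx => ⟨by linarith [hx.2], by linarith [hx.1]⟩
  obtain ⟨⟨w₀, hw₀⟩, H⟩ := leftProductRule hα0 hα1 hψ' h.comp_neg
  refine ⟨⟨fun x => w₀ (-x), ?_⟩, fun w hw => ?_⟩
  · simpa only [neg_neg] using hw₀.comp_neg
  have hae := H _ hw.comp_neg
  rw [ae_restrict_iff' measurableSet_Ioo] at hae ⊢
  filter_upwards [(Measure.measurePreserving_neg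
    (volume : Measure ℝ)).quasiMeasurePreserving.ae hae] with x hx hxab
  obtain ⟨h1, h2, h3⟩ := hx ⟨neg_lt_neg hxab.2, neg_lt_neg hxab.1⟩
  refine ⟨fun k hk => ?_, ?_, ?_⟩
  · have := h1 k hk
    rwa [leftRLIntegrand_comp_neg, integrableOn_Ioo_comp_neg] at this
  · rw [leftRemainderIntegrand_comp_neg] at h2
    rw [← integrableOn_Ioo_comp_neg]
    refine (integrable_const_mul_iff (c := (-1 : ℝ) ^ (m + 1)) ?_ _).1 h2
    exact (isUnit_one.neg).pow _
  · simp only [neg_neg, leftRLIntegral_comp_neg, leftRemainder_comp_neg, derivOn_comp_neg] at h3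
    rw [h3]
    congr 2
    refine Finset.sum_congr rfl fun k _ => ?_
    ring

theorem mainTheorem6 (a b : ℝ) (hab : a < b) (α : ℝ) (hα0 : 0 < α) (hα1 : α < 1)
    (m : ℕ) (hm : 1 ≤ m) (ψ : ℝ → ℝ) (hψ : ContDiffOn ℝ ((m + 1 : ℕ) : ℕ∞) ψ (Icc a b))
    (u v : ℝ → ℝ) :
    (IsLeftWeakFracDeriv a b α u v →
      (∃ w, IsLeftWeakFracDeriv a b α (fun x => u x * ψ x) w) ∧
      (∀ w, IsLeftWeakFracDeriv a b α (fun x => u x * ψ x) w →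
        ∀ᵐ x ∂(volume.restrict (Ioo a b)),
          (∀ k ∈ Finset.Icc 1 m, IntegrableOn (leftRLIntegrand (k - α) u x) (Ioo a x)) ∧
          IntegrableOn (leftRemainderIntegrand a b α m u ψ x) (Ioo a x) ∧
          w x = v x * ψ x
            + ∑ k ∈ Finset.Icc 1 m,
                fracBinom α k * leftRLIntegral a (k - α) u x * derivOn a b k ψ x
            + leftRemainder a b α m u ψ x)) ∧
    (IsRightWeakFracDeriv a b α u v →
      (∃ w, IsRightWeakFracDeriv a b α (fun x => u x * ψ x) w) ∧
      (∀ w, IsRightWeakFracDeriv a b α (fun x => u x * ψ x) w →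
        ∀ᵐ x ∂(volume.restrict (Ioo a b)),
          (∀ k ∈ Finset.Icc 1 m, IntegrableOn (rightRLIntegrand (k - α) u x) (Ioo x b)) ∧
          IntegrableOn (rightRemainderIntegrand a b α m u ψ x) (Ioo x b) ∧
          w x = v x * ψ x
            + ∑ k ∈ Finset.Icc 1 m,
                (-1) ^ k * fracBinom α k * rightRLIntegral b (k - α) u x * derivOn a b k ψ x
            + rightRemainder a b α m u ψ x)) := by
  exact ⟨fun h => leftProductRule hα0 hα1 hψ h, fun h => rightProductRule hα0 hα1 hψ h⟩
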